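/- Let $(\Omega,\Sigma,\mu)$ be a measure space and let $\mathcal A\subseteq\Sigma$ be a sub-$\sigma$-algebra on which $\mu$ is $\sigma$-finite. Let $E$ be the conditional expectation with respect to $\mathcal A$. It is defined with values in $[0,\infty]$ for all nonnegative $\Sigma$-measurable functions, and with values in $\mathbb C$ for all $\Sigma$-measurable $f:\Omega\to\mathbb C$ such that $E(|f|)<\infty$ a.e. (we then say that $E(f)$ is defined). A Young function is a continuous, convex, even function $\Phi:\mathbb R\to[0,\infty)$ such that $\Phi(x)=0$ if and only if $x=0$, and $\Phi(x)/x\to\infty$ as $x\to\infty$. Let $\Phi$ be a Young function. Put $\Psi(y)=\sup\{x|y|-\Phi(x):x\ge 0\}$ for $y\in\mathbb R$. For $\Theta\in\{\Phi,\Psi\}$ and $t\in[0,\infty]$ put $\Theta^{-1}(t)=\sup\{s\ge 0:\Theta(s)\le t\}\in[0,\infty]$; where $\Theta$ is a bijection of $[0,\infty)$, this is the usual inverse, with $\Theta^{-1}(\infty)=\infty$. For complex-valued $f$ write $\Theta(f)=\Theta(|f|)$. Let $L^{\Theta}(\Sigma)$ be the space of $\Sigma$-measurable $f:\Omega\to\mathbb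 C$ with $\int_\Omega\Theta(kf)\,d\mu<\infty$ for some $k>0$, and let $N_\Phi(f)=\inf\{k>0:\int_\Omega\Phi(f/k)\,d\mu\le 1\}$ be the norm of $L^\Phi(\Sigma)$. We say that $\Phi\in\Delta'$ globally if there is $c>0$ such that $\Phi(xy)\le c\,\Phi(x)\Phi(y)$ for all $x,y\ge 0$. We say that $(E,\Phi)$ satisfies the generalized conditional Hölder inequality with constant $C>0$ if, for all $f\in L^\Phi(\Sigma)$ and $g\in L^\Psi(\Sigma)$, $$E(|fg|)\le C\,\Phi^{-1}(E(\Phi(|f|)))\,\Psi^{-1}(E(\Psi(|g|)))\quad\text{a.e.},$$ as an inequality in $[0,\infty]$ with $0\cdot\infty=0$. **Theorem.** Let $u:\Omega\to\mathbb C$ be $\Sigma$-measurable, and suppose that $T=EM_u$, $T(f)=E(uf)$, is well defined on $L^\Phi(\Sigma)$, that is, $E(uf)$ is defined for every $f\in L^\Phi(\Sigma)$. We say that $T$ is bounded if it maps $L^\Phi(\Sigma)$ into itself and there is $K<\infty$ with $N_\Phi(Tf)\le K N_\Phi(f)$ for all $f\in L^\Phi(\Sigma)$; the least such $K$ is $\|T\|$.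 (a) If $T$ is bounded, then $E(u)$ is defined and $E(u)\in L^\infty(\Omega,\mathcal A,\mu)$. (b) Suppose that $\Psi(y)=0$ only for $y=0$. If $\Phi\in\Delta'$ globally and $T$ is bounded, then $\Psi^{-1}(E(\Psi(u)))\in L^\infty(\Omega,\mathcal A,\mu)$. (c) If $(E,\Phi)$ satisfies the generalized conditional Hölder inequality with constant $C>0$ and $\Psi^{-1}(E(\Psi(u)))\in L^\infty(\Omega,\mathcal A,\mu)$, then $T$ is bounded and $\|T\|\le C\,\|\Psi^{-1}(E(\Psi(u)))\|_\infty$. -/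

import Mathlib

open MeasureTheory Filter Topology
open scoped ENNReal NNReal

namespace OrliczEMu

/-- Young functions: continuous, convex, even, nonnegative functions on `ℝ` that vanish exactly at
the origin and grow superlinearly at infinity. -/
structure IsYoung (Φ : ℝ → ℝ) : Prop where
  nonneg : ∀ x, 0 ≤ Φ x
  continuous : Continuous Φ
  convexOn : ConvexOn ℝ Set.univ Φ
  eq_zero_iff : ∀ x, Φ x = 0 ↔ x = 0
  even : ∀ x, Φ (-x) = Φ x
  tendsto_div : Tendsto (fun x => Φ x / x) atTop atTop
  tendsto : Tendsto Φ atTop atTop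

/-- The complementary function `Ψ(y) = sup {x|y| - Φ(x) : x ≥ 0}`. For a Young function `Φ` the
set on the right is nonempty and bounded above. -/
noncomputable def complYoung (Φ : ℝ → ℝ) (y : ℝ) : ℝ :=
  sSup ((fun x : ℝ => x * |y| - Φ x) '' Set.Ici 0)

/-- The inverse `t ↦ sup {s ≥ 0 : Φ(s) ≤ t}` on `[0,∞]` of (the restriction to `[0,∞)` of) `Φ`.
It is the usual inverse, extended by `∞ ↦ ∞`, when `Φ` is an increasing bijection of `[0,∞)`. -/
noncomputable def youngInv (Φ : ℝ → ℝ) (t : ℝ≥0∞) : ℝ≥0∞ :=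
  ⨆ (s : ℝ≥0) (_ : ENNReal.ofReal (Φ s) ≤ t), (s : ℝ≥0∞)

/-- The condition `Δ'`, globally: `Φ(xy) ≤ c Φ(x) Φ(y)` for all `x, y ≥ 0`. -/
def DeltaPrime (Φ : ℝ → ℝ) : Prop :=
  ∃ c : ℝ, 0 < c ∧ ∀ x y : ℝ, 0 ≤ x → 0 ≤ y → Φ (x * y) ≤ c * Φ x * Φ y

section

variable {Ω : Type*} (𝒜 : MeasurableSpace Ω) [mΩ : MeasurableSpace Ω]

/-- Membership in the Orlicz space `L^Φ(Σ)` of complex-valued functions. -/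
def MemOrlicz (Φ : ℝ → ℝ) (μ : Measure Ω) (f : Ω → ℂ) : Prop :=
  Measurable f ∧ ∃ k : ℝ, 0 < k ∧ ∫⁻ ω, ENNReal.ofReal (Φ (k * ‖f ω‖)) ∂μ < ∞

/-- The Luxemburg norm `N_Φ(f) = inf {k > 0 : ∫ Φ(|f|/k) dμ ≤ 1}`, with values in `[0,∞]`. -/
noncomputable def luxNorm (Φ : ℝ → ℝ) (μ : Measure Ω) (f : Ω → ℂ) : ℝ≥0∞ :=
  ⨅ (k : ℝ) (_ : 0 < k) (_ : ∫⁻ ω, ENNReal.ofReal (Φ (‖f ω‖ / k)) ∂μ ≤ 1), ENNReal.ofReal k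

/-- `f` has a conditional expectation given `𝒜`: it is measurable and `E(|f|) < ∞` a.e.
Here `condLExp 𝒜 μ` is the `[0,∞]`-valued conditional expectation of nonnegative functions. -/
def Conditionable (μ : Measure Ω) (f : Ω → ℂ) : Prop :=
  Measurable f ∧ ∀ᵐ ω ∂μ, condLExp 𝒜 μ (fun ω => ‖f ω‖ₑ) ω < ∞

/-- The conditional expectation `E(f)` of a complex function `f` with `E(|f|) < ∞` a.e., obtained
from the positive and negative parts of the real and imaginary parts of `f`. -/
noncomputable def condE (μ : Measure Ω) (f : Ω → ℂ) (ω : Ω) : ℂ :=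
  (((condLExp 𝒜 μ (fun ω => ENNReal.ofReal (f ω).re) ω).toReal
    - (condLExp 𝒜 μ (fun ω => ENNReal.ofReal (-(f ω).re)) ω).toReal : ℝ) : ℂ)
  + (((condLExp 𝒜 μ (fun ω => ENNReal.ofReal (f ω).im) ω).toReal
    - (condLExp 𝒜 μ (fun ω => ENNReal.ofReal (-(f ω).im)) ω).toReal : ℝ) : ℂ) * Complex.I

/-- The function `Θ⁻¹(E(Θ(|f|)))`, with values in `[0,∞]`. -/
noncomputable def invCondE (μ : Measure Ω) (Θ : ℝ → ℝ) (f : Ω → ℂ) (ω : Ω) : ℝ≥0∞ :=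
  youngInv Θ (condLExp 𝒜 μ (fun ω => ENNReal.ofReal (Θ ‖f ω‖)) ω)

/-- The generalized conditional Hölder inequality for `(E, Φ)` with the constant `C`:
`E(|fg|) ≤ C Φ⁻¹(E(Φ(|f|))) Ψ⁻¹(E(Ψ(|g|)))` a.e. for all `f ∈ L^Φ(Σ)` and `g ∈ L^Ψ(Σ)`. -/
def CondHolder (μ : Measure Ω) (Φ : ℝ → ℝ) (C : ℝ≥0) : Prop :=
  ∀ f g : Ω → ℂ, MemOrlicz Φ μ f → MemOrlicz (complYoung Φ) μ g →
    ∀ᵐ ω ∂μ, condLExp 𝒜 μ (fun ω => ‖f ω * g ω‖ₑ) ω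
      ≤ C * invCondE 𝒜 μ Φ f ω * invCondE 𝒜 μ (complYoung Φ) g ω

/-- The operator `T = E M_u`, `T(f) = E(uf)`. -/
noncomputable def EM (μ : Measure Ω) (u f : Ω → ℂ) : Ω → ℂ :=
  condE 𝒜 μ (fun ω => u ω * f ω)

/-- `T = E M_u` is well defined on `L^Φ(Σ)`: `uf` has a conditional expectation for every
`f ∈ L^Φ(Σ)`. -/
def EMWellDefined (μ : Measure Ω) (Φ : ℝ → ℝ) (u : Ω → ℂ) : Prop :=
  ∀ f : Ω → ℂ, MemOrlicz Φ μ f → Conditionable 𝒜 μ (fun ω => u ω * f ω)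

/-- `T = E M_u` is bounded on `L^Φ(Σ)`: it maps `L^Φ(Σ)` into itself and
`N_Φ(T f) ≤ K N_Φ(f)` for some finite `K`. -/
def EMBounded (μ : Measure Ω) (Φ : ℝ → ℝ) (u : Ω → ℂ) : Prop :=
  (∀ f : Ω → ℂ, MemOrlicz Φ μ f → MemOrlicz Φ μ (EM 𝒜 μ u f)) ∧
  ∃ K : ℝ≥0, ∀ f : Ω → ℂ, MemOrlicz Φ μ f →
    luxNorm Φ μ (EM 𝒜 μ u f) ≤ K * luxNorm Φ μ f

/-- The operator norm of `T = E M_u` on `L^Φ(Σ)`, the least `K` with `N_Φ(T f) ≤ K N_Φ(f)`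
for all `f` (`∞` if there is none). -/
noncomputable def EMNorm (μ : Measure Ω) (Φ : ℝ → ℝ) (u : Ω → ℂ) : ℝ≥0∞ :=
  ⨅ (K : ℝ≥0) (_ : ∀ f : Ω → ℂ, MemOrlicz Φ μ f →
    luxNorm Φ μ (EM 𝒜 μ u f) ≤ K * luxNorm Φ μ f), (K : ℝ≥0∞)

end

end OrliczEMu

/-! Part (a) tests `T` on indicators: `T 1_B = 1_B E(u)` for `B ∈ 𝒜`. If `|E(u)| > K + 1` on some
`B` of positive finite measure, then `N_Φ(T 1_B) ≥ (K + 1) N_Φ(1_B)`, which contradicts the bound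
`K`.

Part (b) uses a nearly extremal function for Young's inequality. For `f = ū Ψ(|u|) / (2|u|²)` one
has `uf = Ψ(|u|)/2` and `Φ(|f|) ≤ Ψ(|u|)/2` (`IsYoung.map_complYoung_div_le`). Cutting off at `|u| ≤
n` makes `W = E(uf)` essentially bounded; let `2m` be its essential supremum, take `B ⊆ {W > m}` in
`𝒜` and `s` with `Φ(s) μ(B) = 1`. By `Δ'`, `Φ(st|f|) ≤ c² Φ(s) Φ(t) Φ(|f|)`, so `N_Φ(1_B f) ≤
1/(st)` once `2m c² Φ(t) ≤ 1`, whereas `N_Φ(T(1_B f)) ≥ m/s`; hence `mt ≤ K`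
(`mul_le_of_luxNorm_EM_le`). Since `Ψ` vanishes only at `0`, `Φ(t) = o(t)` at `0`, so for large `m`
the choice `t = 2(K + 1)/m` is allowed and contradicts this. Thus `m` is bounded independently of
`n`, and monotone convergence removes the cutoff.

In part (c), with `M` the essential bound, Hölder's inequality gives `|Tf|/k ≤ E(|uf|)/k ≤ C M
Φ⁻¹(E(Φ(|f|/k)))`. Applying `Φ` and integrating removes `E` (`lintegral_EM_div_le`). -/

namespace OrliczEMu

/-! ### Young functions, their complements and inverses. -/

section Young

variable {Φ : ℝ → ℝ}

lemma IsYoung.map_zero (hΦ : IsYoung Φ) : Φ 0 = 0 := (hΦ.eq_zero_iff 0).2 rfl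

lemma IsYoung.pos (hΦ : IsYoung Φ) {x : ℝ} (hx : 0 < x) : 0 < Φ x :=
  lt_of_le_of_ne (hΦ.nonneg x) fun h => hx.ne' ((hΦ.eq_zero_iff x).1 h.symm)

lemma IsYoung.map_mul_le (hΦ : IsYoung Φ) {t : ℝ} (ht₀ : 0 ≤ t) (ht₁ : t ≤ 1) (x : ℝ) :
    Φ (t * x) ≤ t * Φ x := by
  have h := hΦ.convexOn.2 (Set.mem_univ x) (Set.mem_univ 0) ht₀ (sub_nonneg.2 ht₁) (by ring)
  simpa [hΦ.map_zero] using h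

lemma IsYoung.strictMonoOn (hΦ : IsYoung Φ) : StrictMonoOn Φ (Set.Ici 0) := by
  intro x (hx : 0 ≤ x) y _ hxy
  have hy : 0 < y := hx.trans_lt hxy
  calc Φ x = Φ (x / y * y) := by rw [div_mul_cancel₀ _ hy.ne']
    _ ≤ x / y * Φ y := hΦ.map_mul_le (by positivity) ((div_le_one hy).2 hxy.le) y
    _ < 1 * Φ y := mul_lt_mul_of_pos_right ((div_lt_one hy).2 hxy) (hΦ.pos hy)
    _ = Φ y := one_mul _

lemma IsYoung.mono (hΦ : IsYoung Φ) {x y : ℝ} (hx : 0 ≤ x) (hxy : x ≤ y) : Φ x ≤ Φ y :=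
  hΦ.strictMonoOn.monotoneOn hx (hx.trans hxy) hxy

lemma IsYoung.le_of_map_le (hΦ : IsYoung Φ) {x y : ℝ} (hx : 0 ≤ x) (hy : 0 ≤ y)
    (h : Φ x ≤ Φ y) : x ≤ y :=
  (hΦ.strictMonoOn.le_iff_le hx hy).1 h

lemma IsYoung.exists_eq (hΦ : IsYoung Φ) {t : ℝ} (ht : 0 ≤ t) : ∃ s, 0 ≤ s ∧ Φ s = t := by
  obtain ⟨b, hb, hb₀⟩ := ((hΦ.tendsto.eventually_ge_atTop t).and (eventually_ge_atTop 0)).exists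
  obtain ⟨s, hs, rfl⟩ := intermediate_value_Icc hb₀ hΦ.continuous.continuousOn
    (show t ∈ Set.Icc (Φ 0) (Φ b) from ⟨by rwa [hΦ.map_zero], hb⟩)
  exact ⟨s, hs.1, rfl⟩

/-- For finite `t` the supremum defining `youngInv Φ t` is attained at the solution of `Φ s = t`. -/
lemma IsYoung.le_of_le_youngInv (hΦ : IsYoung Φ) {x : ℝ} (hx : 0 ≤ x) {t : ℝ≥0∞}
    (h : ENNReal.ofReal x ≤ youngInv Φ t) : ENNReal.ofReal (Φ x) ≤ t := by
  rcases eq_or_ne t ∞ with rfl | ht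
  · exact le_top
  obtain ⟨s, hs, hst⟩ := hΦ.exists_eq (ENNReal.toReal_nonneg (a := t))
  have hs' : youngInv Φ t ≤ ENNReal.ofReal s := by
    refine iSup₂_le fun r hr => ?_
    rw [← ENNReal.ofReal_toReal ht, ← hst, ENNReal.ofReal_le_ofReal_iff (hΦ.nonneg s)] at hr
    rw [← ENNReal.ofReal_coe_nnreal]
    exact ENNReal.ofReal_le_ofReal (hΦ.le_of_map_le r.2 hs hr)
  rw [← ENNReal.ofReal_toReal ht, ← hst]
  exact ENNReal.ofReal_le_ofReal
    (hΦ.mono hx ((ENNReal.ofReal_le_ofReal_iff hs).1 (h.trans hs')))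

lemma youngInv_mono (Θ : ℝ → ℝ) : Monotone (youngInv Θ) := fun _ _ h =>
  iSup₂_le fun s hs => le_iSup₂_of_le s (hs.trans h) le_rfl

lemma IsYoung.bddAbove (hΦ : IsYoung Φ) (y : ℝ) :
    BddAbove ((fun x : ℝ => x * |y| - Φ x) '' Set.Ici 0) := by
  obtain ⟨X, hX⟩ := eventually_atTop.1
    ((hΦ.tendsto_div.eventually_ge_atTop |y|).and (eventually_gt_atTop 0))
  refine ⟨X * |y|, ?_⟩
  rintro _ ⟨x, hx : 0 ≤ x, rfl⟩
  have hX₀ := (hX X le_rfl).2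
  rcases le_total X x with h | h
  · obtain ⟨h₁, h₂⟩ := hX x h
    rw [le_div_iff₀ h₂] at h₁
    have : 0 ≤ X * |y| := by positivity
    simp only
    linarith
  · have := mul_le_mul_of_nonneg_right h (abs_nonneg y)
    have := hΦ.nonneg x
    simp only
    linarith

lemma IsYoung.le_complYoung (hΦ : IsYoung Φ) {x : ℝ} (hx : 0 ≤ x) (y : ℝ) :
    x * |y| - Φ x ≤ complYoung Φ y :=
  le_csSup (hΦ.bddAbove y) ⟨x, hx, rfl⟩

lemma complYoung_le {y a : ℝ} (h : ∀ x, 0 ≤ x → x * |y| - Φ x ≤ a) : complYoung Φ y ≤ a :=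
  csSup_le ⟨_, 0, Set.self_mem_Ici, rfl⟩ (by rintro _ ⟨x, hx, rfl⟩; exact h x hx)

lemma IsYoung.complYoung_nonneg (hΦ : IsYoung Φ) (y : ℝ) : 0 ≤ complYoung Φ y := by
  simpa [hΦ.map_zero] using hΦ.le_complYoung le_rfl y

lemma IsYoung.complYoung_zero (hΦ : IsYoung Φ) : complYoung Φ 0 = 0 :=
  le_antisymm (complYoung_le fun x _ => by simpa using hΦ.nonneg x) (hΦ.complYoung_nonneg 0)

lemma IsYoung.complYoung_mono (hΦ : IsYoung Φ) {y z : ℝ} (h : |y| ≤ |z|) :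
    complYoung Φ y ≤ complYoung Φ z :=
  complYoung_le fun _ hx => le_trans
    (sub_le_sub_right (mul_le_mul_of_nonneg_left h hx) _) (hΦ.le_complYoung hx z)

lemma IsYoung.measurable_complYoung (hΦ : IsYoung Φ) : Measurable (complYoung Φ) := by
  -- `Ψ` is even and increasing on `[0,∞)`: a monotone function composed with the absolute value.
  have h : Monotone fun y : ℝ => complYoung Φ (max y 0) := fun y z hyz =>
    hΦ.complYoung_mono (by
      rw [abs_of_nonneg (le_max_right _ _), abs_of_nonneg (le_max_right _ _)]
      exact max_le_max_right 0 hyz)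
  convert h.measurable.comp (measurable_norm (α := ℝ)) using 1
  ext y
  simp [complYoung]

/-- A version of `Φ(Ψ(y)/y) ≤ Ψ(y)`. -/
lemma IsYoung.map_complYoung_div_le (hΦ : IsYoung Φ) {y : ℝ} (hy : 0 < y) :
    Φ (complYoung Φ y / (2 * y)) ≤ complYoung Φ y / 2 := by
  set x := complYoung Φ y / (2 * y) with hx
  have hxy : complYoung Φ y / 2 = x * y := by rw [hx]; field_simp
  have hx₀ : 0 ≤ x := div_nonneg (hΦ.complYoung_nonneg y) (by positivity)
  -- If `Φ x > x * y`, convexity gives `Φ z ≥ z * y` for `z ≥ x`, so such `z` contribute nothing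
  -- positive to the supremum. The others contribute at most `x * y`, half of `Ψ(y)`.
  by_contra! hlt
  have hpos : 0 < Φ x := (div_nonneg (hΦ.complYoung_nonneg y) zero_le_two).trans_lt hlt
  have hx₁ : 0 < x := lt_of_le_of_ne hx₀ fun h => by simp [← h, hΦ.map_zero] at hpos
  have hle : complYoung Φ y ≤ x * y := complYoung_le fun z hz => by
    rw [abs_of_pos hy]
    rcases le_total z x with h | h
    · nlinarith [hΦ.nonneg z, mul_le_mul_of_nonneg_right h hy.le]
    · have hz' : 0 < z := hx₁.trans_le h
      have h₁ := hΦ.map_mul_le (div_nonneg hx₀ hz) ((div_le_one hz').2 h) z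
      rw [div_mul_cancel₀ _ hz'.ne', div_mul_eq_mul_div, le_div_iff₀ hz'] at h₁
      have h₂ : x * y * z ≤ x * Φ z := by
        rw [hxy] at hlt
        nlinarith
      have h₃ : z * y ≤ Φ z := by nlinarith
      nlinarith [mul_pos hx₁ hy]
  have : 0 < x * y := mul_pos hx₁ hy
  linarith

/-- If the complementary function vanishes only at the origin, then `Φ(x) = o(x)` at `0`. -/
lemma IsYoung.exists_forall_le_mul (hΦ : IsYoung Φ) (hΨ : ∀ y, complYoung Φ y = 0 → y = 0)
    {δ : ℝ} (hδ : 0 < δ) : ∃ x₀, 0 < x₀ ∧ ∀ x, 0 ≤ x → x ≤ x₀ → Φ x ≤ δ * x := by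
  -- Otherwise `Ψ(δ) = 0`. A single chord from the origin of slope below `δ` suffices, since by
  -- convexity `Φ(x)/x` increases.
  have h : ¬ ∀ x, 0 ≤ x → x * |δ| - Φ x ≤ 0 := fun h =>
    hδ.ne' (hΨ δ (le_antisymm (complYoung_le h) (hΦ.complYoung_nonneg δ)))
  push Not at h
  obtain ⟨x₀, hx₀, hlt⟩ := h
  rw [abs_of_pos hδ] at hlt
  have hpos : 0 < x₀ := lt_of_le_of_ne hx₀ fun h => by simp [← h, hΦ.map_zero] at hlt
  refine ⟨x₀, hpos, fun x hx hxx => ?_⟩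
  calc Φ x = Φ (x / x₀ * x₀) := by rw [div_mul_cancel₀ _ hpos.ne']
    _ ≤ x / x₀ * Φ x₀ := hΦ.map_mul_le (by positivity) ((div_le_one hpos).2 hxx) x₀
    _ ≤ x / x₀ * (x₀ * δ) := by gcongr; linarith
    _ = δ * x := by field_simp

/-- Taking `x = 1` in the supremum gives `Ψ(s) ≥ s - Φ(1)`. -/
lemma IsYoung.youngInv_complYoung_le (hΦ : IsYoung Φ) {a : ℝ} (ha : 0 ≤ a) :
    youngInv (complYoung Φ) (ENNReal.ofReal a) ≤ ENNReal.ofReal (a + Φ 1) := by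
  refine iSup₂_le fun s hs => ?_
  rw [ENNReal.ofReal_le_ofReal_iff ha] at hs
  rw [← ENNReal.ofReal_coe_nnreal]
  refine ENNReal.ofReal_le_ofReal ?_
  have := hΦ.le_complYoung zero_le_one s
  rw [NNReal.abs_eq] at this
  linarith

lemma lt_of_youngInv_lt {Θ : ℝ → ℝ} {t : ℝ≥0∞} {s : ℝ≥0} (h : youngInv Θ t < s) :
    t < ENNReal.ofReal (Θ s) := by
  by_contra! hle
  exact h.not_ge (le_iSup₂_of_le s hle le_rfl)

end Young

/-! ### Conditional expectations in `[0,∞]` and in `ℂ`. -/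

section CondExp

variable {Ω : Type*} {𝒜 mΩ : MeasurableSpace Ω} {μ : Measure Ω}

lemma condLExp_indicator (h𝒜 : 𝒜 ≤ mΩ) [SigmaFinite (μ.trim h𝒜)] (X : Ω → ℝ≥0∞) {B : Set Ω}
    (hB : MeasurableSet[𝒜] B) :
    condLExp 𝒜 μ (B.indicator X) =ᵐ[μ] B.indicator (condLExp 𝒜 μ X) := by
  refine (ae_eq_condLExp h𝒜 μ _ ((measurable_condLExp 𝒜 μ X).indicator hB) fun s hs => ?_).symm
  rw [setLIntegral_indicator (h𝒜 _ hB), setLIntegral_indicator (h𝒜 _ hB),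
    setLIntegral_condLExp h𝒜 μ X (hB.inter hs)]

lemma condLExp_const_mul (h𝒜 : 𝒜 ≤ mΩ) [SigmaFinite (μ.trim h𝒜)] (X : Ω → ℝ≥0∞) {c : ℝ≥0∞}
    (hc : c ≠ ∞) :
    condLExp 𝒜 μ (fun ω => c * X ω) =ᵐ[μ] fun ω => c * condLExp 𝒜 μ X ω :=
  condLExp_smul' X hc

lemma condLExp_sum_mul (h𝒜 : 𝒜 ≤ mΩ) [SigmaFinite (μ.trim h𝒜)] {n : ℕ} (c : Fin n → ℝ≥0∞)
    (hc : ∀ i, c i ≠ ∞) (X : Fin n → Ω → ℝ≥0∞) (hX : ∀ i, Measurable (X i)) :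
    condLExp 𝒜 μ (fun ω => ∑ i, c i * X i ω) =ᵐ[μ] fun ω => ∑ i, c i * condLExp 𝒜 μ (X i) ω := by
  have h := condLExp_finsetSum (P := μ) 𝒜 Finset.univ (X := fun i ω => c i * X i ω)
    fun i => ((hX i).const_mul (c i)).aemeasurable
  have h' : ∀ᵐ ω ∂μ, ∀ i, condLExp 𝒜 μ (fun ω => c i * X i ω) ω = c i * condLExp 𝒜 μ (X i) ω :=
    ae_all_iff.2 fun i => condLExp_const_mul h𝒜 (X i) (hc i)
  have e : (fun ω => ∑ i, c i * X i ω) = ∑ i, fun ω => c i * X i ω := by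
    ext ω
    simp
  rw [e]
  filter_upwards [h, h'] with ω h₁ h₂
  rw [h₁, Finset.sum_apply]
  exact Finset.sum_congr rfl fun i _ => h₂ i

/-- Monotone convergence, carried out on integrals over sets of `𝒜`, which determine the conditional
expectation. -/
lemma condLExp_le_of_monotone (h𝒜 : 𝒜 ≤ mΩ) [SigmaFinite (μ.trim h𝒜)] {X : ℕ → Ω → ℝ≥0∞}
    (hX : ∀ n, Measurable (X n)) (hmono : Monotone X) {c : ℝ≥0∞}
    (hc : ∀ n, condLExp 𝒜 μ (X n) ≤ᵐ[μ] fun _ => c) :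
    condLExp 𝒜 μ (fun ω => ⨆ n, X n ω) ≤ᵐ[μ.trim h𝒜] fun _ => c := by
  refine ae_le_of_forall_setLIntegral_le_of_sigmaFinite (measurable_condLExp 𝒜 μ _)
    fun s hs _ => ?_
  rw [setLIntegral_condLExp_trim h𝒜 μ _ hs, lintegral_iSup hX hmono]
  refine iSup_le fun n => ?_
  rw [← setLIntegral_condLExp h𝒜 μ _ hs, setLIntegral_const, trim_measurableSet_eq h𝒜 hs,
    ← setLIntegral_const]
  exact lintegral_mono_ae (ae_restrict_of_ae (hc n))

lemma measurable_condE (f : Ω → ℂ) : Measurable[𝒜] (condE 𝒜 μ f) := by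
  unfold condE
  have h := fun X : Ω → ℝ≥0∞ => (measurable_condLExp 𝒜 μ X).ennreal_toReal
  exact (Complex.measurable_ofReal.comp ((h _).sub (h _))).add
    ((Complex.measurable_ofReal.comp ((h _).sub (h _))).mul_const _)

lemma condE_indicator (h𝒜 : 𝒜 ≤ mΩ) [SigmaFinite (μ.trim h𝒜)] (f : Ω → ℂ) {B : Set Ω}
    (hB : MeasurableSet[𝒜] B) :
    condE 𝒜 μ (B.indicator f) =ᵐ[μ] B.indicator (condE 𝒜 μ f) := by
  have h : ∀ p : ℂ → ℝ≥0∞, p 0 = 0 →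
      condLExp 𝒜 μ (fun ω => p (B.indicator f ω)) =ᵐ[μ]
        B.indicator (condLExp 𝒜 μ fun ω => p (f ω)) := fun p hp => by
    have e : (fun ω => p (B.indicator f ω)) = B.indicator fun ω => p (f ω) :=
      (Set.indicator_comp_of_zero hp).symm
    rw [e]
    exact condLExp_indicator h𝒜 _ hB
  filter_upwards [h (fun z => ENNReal.ofReal z.re) (by simp),
    h (fun z => ENNReal.ofReal (-z.re)) (by simp), h (fun z => ENNReal.ofReal z.im) (by simp),
    h (fun z => ENNReal.ofReal (-z.im)) (by simp)] with ω h₁ h₂ h₃ h₄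
  unfold condE
  rw [h₁, h₂, h₃, h₄]
  by_cases hω : ω ∈ B <;> simp [hω]

lemma condE_ofReal {r : Ω → ℝ} (hr : ∀ ω, 0 ≤ r ω) :
    condE 𝒜 μ (fun ω => (r ω : ℂ)) =
      fun ω => ((condLExp 𝒜 μ (fun ω => ENNReal.ofReal (r ω)) ω).toReal : ℂ) := by
  have h₁ : (fun ω => ENNReal.ofReal (-r ω)) = 0 := by
    ext ω
    simp [hr ω]
  have h₂ : (fun _ : Ω => (0 : ℝ≥0∞)) = 0 := rfl
  ext ω
  simp [condE, h₁, h₂]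

/-- Splitting `a` and `b` into positive and negative parts and moving the negative terms across
removes all subtraction, so the inequality can pass through `condLExp` in `[0,∞]`. -/
lemma sum_le_sum_iff_linear (a b : ℝ) {p n q m r : ℝ≥0∞} (hp : p ≠ ∞) (hn : n ≠ ∞) (hq : q ≠ ∞)
    (hm : m ≠ ∞) (hr : r ≠ ∞) :
    ENNReal.ofReal a * p + ENNReal.ofReal (-a) * n + ENNReal.ofReal b * q
        + ENNReal.ofReal (-b) * m ≤
      ENNReal.ofReal (-a) * p + ENNReal.ofReal a * n + ENNReal.ofReal (-b) * q
        + ENNReal.ofReal b * m + ENNReal.ofReal ‖(⟨a, b⟩ : ℂ)‖ * r ↔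
    a * (p.toReal - n.toReal) + b * (q.toReal - m.toReal) ≤ ‖(⟨a, b⟩ : ℂ)‖ * r.toReal := by
  lift p to ℝ≥0 using hp
  lift n to ℝ≥0 using hn
  lift q to ℝ≥0 using hq
  lift m to ℝ≥0 using hm
  lift r to ℝ≥0 using hr
  have ha : a = a.toNNReal - (-a).toNNReal := by
    simp only [Real.coe_toNNReal']
    exact (max_zero_sub_max_neg_zero_eq_self a).symm
  have hb : b = b.toNNReal - (-b).toNNReal := by
    simp only [Real.coe_toNNReal']
    exact (max_zero_sub_max_neg_zero_eq_self b).symm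
  have hw : ‖(⟨a, b⟩ : ℂ)‖ = ‖(⟨a, b⟩ : ℂ)‖₊ := rfl
  rw [hw, ENNReal.ofReal_coe_nnreal]
  unfold ENNReal.ofReal
  norm_cast
  rw [← NNReal.coe_le_coe]
  push_cast
  simp only [ENNReal.coe_toReal]
  generalize ‖(⟨a, b⟩ : ℂ)‖₊ = w at *
  generalize a.toNNReal = a₁ at *
  generalize (-a).toNNReal = a₂ at *
  generalize b.toNNReal = b₁ at *
  generalize (-b).toNNReal = b₂ at *
  rw [ha, hb]
  constructor <;> intro h <;> linarith

lemma linear_le_norm_mul_norm (a b : ℝ) (z : ℂ) : a * z.re + b * z.im ≤ ‖(⟨a, b⟩ : ℂ)‖ * ‖z‖ := by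
  have h := Complex.re_le_norm (starRingEnd ℂ ⟨a, b⟩ * z)
  rw [norm_mul, Complex.norm_conj] at h
  simpa using h

/-- Density extends the hypothesis to real pairs; the pair `(x, y)` itself then gives `‖z‖² ≤ ‖z‖
r`. -/
lemma norm_le_of_forall_rat {x y r : ℝ}
    (h : ∀ a b : ℚ, (a : ℝ) * x + b * y ≤ ‖(⟨a, b⟩ : ℂ)‖ * r) : ‖(⟨x, y⟩ : ℂ)‖ ≤ r := by
  have hc : Continuous fun p : ℝ × ℝ => (⟨p.1, p.2⟩ : ℂ) := Complex.equivRealProdCLM.symm.continuous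
  have hall : ∀ p : ℝ × ℝ, p.1 * x + p.2 * y ≤ ‖(⟨p.1, p.2⟩ : ℂ)‖ * r := fun p =>
    (Rat.denseRange_cast.prodMap Rat.denseRange_cast).induction_on p
      (isClosed_le (by fun_prop) (hc.norm.mul_const r)) fun q => h q.1 q.2
  have h₁ := hall (x, y)
  have h₂ : ‖(⟨x, y⟩ : ℂ)‖ * ‖(⟨x, y⟩ : ℂ)‖ = x * x + y * y := by
    rw [Complex.norm_mul_self_eq_normSq, Complex.normSq_mk]
  rw [← h₂] at h₁
  rcases (norm_nonneg (⟨x, y⟩ : ℂ)).eq_or_lt with h₀ | h₀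
  -- Cancelling `‖z‖` is impossible when `z = 0`; there `0 ≤ r` comes from the pair `(1, 0)`.
  · have h₃ := h 1 0
    have hz : (⟨x, y⟩ : ℂ) = 0 := norm_eq_zero.1 h₀.symm
    have hx : x = 0 := congrArg Complex.re hz
    have e : (⟨1, 0⟩ : ℂ) = 1 := rfl
    simp [hx, e] at h₃
    rwa [← h₀]
  · exact le_of_mul_le_mul_left h₁ h₀

/-- The modulus is recovered from real linear functionals, each of which commutes with `E`. Rational
coefficients leave only countably many null sets. -/
lemma enorm_condE_le (h𝒜 : 𝒜 ≤ mΩ) [SigmaFinite (μ.trim h𝒜)] {f : Ω → ℂ}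
    (hf : Conditionable 𝒜 μ f) :
    ∀ᵐ ω ∂μ, ‖condE 𝒜 μ f ω‖ₑ ≤ condLExp 𝒜 μ (fun ω => ‖f ω‖ₑ) ω := by
  obtain ⟨hfm, hfin⟩ := hf
  have hbound : ∀ {p : ℂ → ℝ}, (∀ z, p z ≤ ‖z‖) → ∀ᵐ ω ∂μ,
      condLExp 𝒜 μ (fun ω => ENNReal.ofReal (p (f ω))) ω ≠ ∞ := fun {p} hp => by
    filter_upwards [hfin, condLExp_mono (mΩ := 𝒜) (P := μ) (X := fun ω => ENNReal.ofReal (p (f ω)))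
      (Y := fun ω => ‖f ω‖ₑ) (ae_of_all _ fun ω => by
        simpa only [ofReal_norm] using ENNReal.ofReal_le_ofReal (hp (f ω)))] with ω h₁ h₂
    exact (h₂.trans_lt h₁).ne
  have hlin : ∀ᵐ ω ∂μ, ∀ a b : ℚ,
      ENNReal.ofReal a * condLExp 𝒜 μ (fun ω => ENNReal.ofReal (f ω).re) ω
        + ENNReal.ofReal (-a) * condLExp 𝒜 μ (fun ω => ENNReal.ofReal (-(f ω).re)) ω
        + ENNReal.ofReal b * condLExp 𝒜 μ (fun ω => ENNReal.ofReal (f ω).im) ω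
        + ENNReal.ofReal (-b) * condLExp 𝒜 μ (fun ω => ENNReal.ofReal (-(f ω).im)) ω ≤
      ENNReal.ofReal (-a) * condLExp 𝒜 μ (fun ω => ENNReal.ofReal (f ω).re) ω
        + ENNReal.ofReal a * condLExp 𝒜 μ (fun ω => ENNReal.ofReal (-(f ω).re)) ω
        + ENNReal.ofReal (-b) * condLExp 𝒜 μ (fun ω => ENNReal.ofReal (f ω).im) ω
        + ENNReal.ofReal b * condLExp 𝒜 μ (fun ω => ENNReal.ofReal (-(f ω).im)) ω
        + ENNReal.ofReal ‖(⟨a, b⟩ : ℂ)‖ * condLExp 𝒜 μ (fun ω => ‖f ω‖ₑ) ω := by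
    refine ae_all_iff.2 fun a => ae_all_iff.2 fun b => ?_
    have h₁ := condLExp_sum_mul (μ := μ) h𝒜
      ![ENNReal.ofReal a, ENNReal.ofReal (-a), ENNReal.ofReal b, ENNReal.ofReal (-b)]
      (by intro i; fin_cases i <;> simp)
      ![fun ω => ENNReal.ofReal (f ω).re, fun ω => ENNReal.ofReal (-(f ω).re),
        fun ω => ENNReal.ofReal (f ω).im, fun ω => ENNReal.ofReal (-(f ω).im)]
      (by intro i; fin_cases i <;> (simp; fun_prop))
    have h₂ := condLExp_sum_mul (μ := μ) h𝒜
      ![ENNReal.ofReal (-a), ENNReal.ofReal a, ENNReal.ofReal (-b), ENNReal.ofReal b,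
        ENNReal.ofReal ‖(⟨a, b⟩ : ℂ)‖]
      (by intro i; fin_cases i <;> simp)
      ![fun ω => ENNReal.ofReal (f ω).re, fun ω => ENNReal.ofReal (-(f ω).re),
        fun ω => ENNReal.ofReal (f ω).im, fun ω => ENNReal.ofReal (-(f ω).im), fun ω => ‖f ω‖ₑ]
      (by intro i; fin_cases i <;> (simp; fun_prop))
    simp only [Fin.sum_univ_four, Fin.sum_univ_five, Matrix.cons_val] at h₁ h₂
    filter_upwards [h₁, h₂, condLExp_mono (mΩ := 𝒜) (P := μ) (ae_of_all μ fun ω =>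
      (sum_le_sum_iff_linear a b (p := ENNReal.ofReal (f ω).re)
        (n := ENNReal.ofReal (-(f ω).re)) (q := ENNReal.ofReal (f ω).im)
        (m := ENNReal.ofReal (-(f ω).im)) (r := ‖f ω‖ₑ) ENNReal.ofReal_ne_top
        ENNReal.ofReal_ne_top ENNReal.ofReal_ne_top ENNReal.ofReal_ne_top enorm_ne_top).2 (by
          simp only [ENNReal.toReal_ofReal', max_zero_sub_max_neg_zero_eq_self, toReal_enorm]
          exact linear_le_norm_mul_norm a b (f ω)))] with ω e₁ e₂ h
    rw [← e₁, ← e₂]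
    exact h
  filter_upwards [hfin, hlin, hbound Complex.re_le_norm,
    hbound (p := fun z => -z.re) fun z => (neg_le_abs _).trans (Complex.abs_re_le_norm z),
    hbound Complex.im_le_norm,
    hbound (p := fun z => -z.im) fun z => (neg_le_abs _).trans (Complex.abs_im_le_norm z)]
    with ω hr hl h₁ h₂ h₃ h₄
  rw [← ENNReal.ofReal_toReal hr.ne, ← ofReal_norm]
  refine ENNReal.ofReal_le_ofReal ?_
  unfold condE
  rw [← Complex.mk_eq_add_mul_I]
  exact norm_le_of_forall_rat fun a b => (sum_le_sum_iff_linear a b h₁ h₂ h₃ h₄ hr.ne).1 (hl a b)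

/-! ### Luxemburg norm estimates on test functions. -/

lemma luxNorm_le {Φ : ℝ → ℝ} {f : Ω → ℂ} {k : ℝ} (hk : 0 < k)
    (h : ∫⁻ ω, ENNReal.ofReal (Φ (‖f ω‖ / k)) ∂μ ≤ 1) : luxNorm Φ μ f ≤ ENNReal.ofReal k :=
  iInf_le_of_le k (iInf₂_le hk h)

/-- Testing the boundedness of `E M_u` on functions supported by a set of finite measure. -/
lemma mul_le_of_luxNorm_EM_le {Φ : ℝ → ℝ} (hΦ : IsYoung Φ) {u : Ω → ℂ} {K : ℝ≥0}
    (hK : ∀ f : Ω → ℂ, MemOrlicz Φ μ f → luxNorm Φ μ (EM 𝒜 μ u f) ≤ K * luxNorm Φ μ f)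
    {f : Ω → ℂ} (hf : Measurable f) {B : Set Ω} (hB : MeasurableSet B) {s t L : ℝ} (hs : 0 < s)
    (hsB : ENNReal.ofReal (Φ s) * μ B = 1) (ht : 0 < t) (hL : 0 ≤ L)
    (hint : ∫⁻ ω, ENNReal.ofReal (Φ (s * t * ‖f ω‖)) ∂μ ≤ 1)
    (hTf : ∀ᵐ ω ∂μ, ω ∈ B → L ≤ ‖EM 𝒜 μ u f ω‖) : L * t ≤ K := by
  have hst : 0 < s * t := mul_pos hs ht
  have hup : luxNorm Φ μ f ≤ ENNReal.ofReal (s * t)⁻¹ := by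
    refine luxNorm_le (inv_pos.2 hst) ?_
    simpa only [div_inv_eq_mul, mul_comm] using hint
  -- An admissible `k` for `T f` satisfies `Φ(L/k) μ(B) ≤ 1 = Φ(s) μ(B)`, hence `L/k ≤ s`.
  have hlow : ENNReal.ofReal (L / s) ≤ luxNorm Φ μ (EM 𝒜 μ u f) := by
    refine le_iInf fun k => le_iInf fun hk => le_iInf fun hkint => ENNReal.ofReal_le_ofReal ?_
    have h₁ : ENNReal.ofReal (Φ (L / k)) * μ B ≤ ENNReal.ofReal (Φ s) * μ B := by
      rw [hsB]
      refine le_trans ?_ hkint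
      rw [← setLIntegral_const]
      refine (setLIntegral_mono_ae' hB ?_).trans (setLIntegral_le_lintegral B _)
      filter_upwards [hTf] with ω h hω
      have := h hω
      exact ENNReal.ofReal_le_ofReal (hΦ.mono (by positivity) (by gcongr))
    have hB₀ : μ B ≠ 0 := fun h => by simp [h] at hsB
    have hB₁ : μ B ≠ ∞ := fun h => by
      have := hΦ.pos hs
      rw [h, ENNReal.mul_top (by simpa using this)] at hsB
      exact ENNReal.top_ne_one hsB
    have h₂ := (ENNReal.ofReal_le_ofReal_iff (hΦ.nonneg s)).1
      ((ENNReal.mul_le_mul_iff_left hB₀ hB₁).1 h₁)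
    have h₃ := hΦ.le_of_map_le (by positivity) hs.le h₂
    rw [div_le_iff₀ hk] at h₃
    rw [div_le_iff₀ hs]
    linarith
  have h := hlow.trans ((hK f ⟨hf, s * t, hst, hint.trans_lt ENNReal.one_lt_top⟩).trans
    (mul_le_mul_right hup _))
  rw [← ENNReal.ofReal_coe_nnreal, ← ENNReal.ofReal_mul K.coe_nonneg,
    ENNReal.ofReal_le_ofReal_iff (by positivity), div_le_iff₀ hs] at h
  calc L * t ≤ K * (s * t)⁻¹ * s * t := by gcongr
    _ = K := by field_simp

/-- A set of positive finite measure on which a given inequality fails, and its normalization. -/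
lemma exists_normalized_subset {Φ : ℝ → ℝ} (hΦ : IsYoung Φ) (h𝒜 : 𝒜 ≤ mΩ)
    [SigmaFinite (μ.trim h𝒜)] {S : Set Ω} (hS : MeasurableSet[𝒜] S) (h₀ : μ.trim h𝒜 S ≠ 0) :
    ∃ B, MeasurableSet[𝒜] B ∧ B ⊆ S ∧ ∃ s, 0 < s ∧ ENNReal.ofReal (Φ s) * μ B = 1 := by
  obtain ⟨B, hB, hBS, hB₀, hB₁⟩ :=
    Measure.exists_subset_measure_lt_top (μ := μ.trim h𝒜) hS (pos_iff_ne_zero.2 h₀)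
  rw [trim_measurableSet_eq h𝒜 hB] at hB₀ hB₁
  obtain ⟨s, hs, hsB⟩ := hΦ.exists_eq (t := ((μ B)⁻¹).toReal) ENNReal.toReal_nonneg
  have hinv : (μ B)⁻¹ ≠ ∞ := ENNReal.inv_ne_top.2 hB₀.ne'
  refine ⟨B, hB, hBS, s, lt_of_le_of_ne hs fun h => ?_, ?_⟩
  · rw [← h, hΦ.map_zero] at hsB
    exact (ENNReal.toReal_pos (ENNReal.inv_ne_zero.2 hB₁.ne) hinv).ne hsB
  · rw [hsB, ENNReal.ofReal_toReal hinv, ENNReal.inv_mul_cancel hB₀.ne' hB₁.ne]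

end CondExp

/-! ### Part (a): indicators as test functions. -/

section Operator

variable {Ω : Type*} {𝒜 mΩ : MeasurableSpace Ω} {μ : Measure Ω} {Φ : ℝ → ℝ} {u : Ω → ℂ}

lemma memOrlicz_indicator_one (hΦ : IsYoung Φ) {B : Set Ω} (hB : MeasurableSet B)
    (hμB : μ B ≠ ∞) : MemOrlicz Φ μ (B.indicator 1) := by
  refine ⟨measurable_one.indicator hB, 1, one_pos, ?_⟩
  have e : (fun ω => ENNReal.ofReal (Φ (1 * ‖B.indicator (1 : Ω → ℂ) ω‖))) =
      B.indicator fun _ => ENNReal.ofReal (Φ 1) := by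
    ext ω
    by_cases hω : ω ∈ B <;> simp [hω, hΦ.map_zero]
  rw [e, lintegral_indicator_const hB]
  exact ENNReal.mul_lt_top ENNReal.ofReal_lt_top hμB.lt_top

/-- The constant `1` need not lie in `L^Φ`, so `T` is applied to indicators of sets of finite
measure exhausting `Ω`. -/
lemma conditionable_of_EMWellDefined (h𝒜 : 𝒜 ≤ mΩ) [SigmaFinite (μ.trim h𝒜)] (hΦ : IsYoung Φ)
    (hu : Measurable u) (hT : EMWellDefined 𝒜 μ Φ u) : Conditionable 𝒜 μ u := by
  refine ⟨hu, ?_⟩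
  have hS := fun n => measurableSet_spanningSets (μ.trim h𝒜) n
  have hfin : ∀ n, ∀ᵐ ω ∂μ, ω ∈ spanningSets (μ.trim h𝒜) n →
      condLExp 𝒜 μ (fun ω => ‖u ω‖ₑ) ω < ∞ := fun n => by
    have h := (hT _ (memOrlicz_indicator_one hΦ (h𝒜 _ (hS n))
      (measure_spanningSets_trim_lt_top h𝒜 μ n).ne)).2
    have e : (fun ω => ‖u ω * (spanningSets (μ.trim h𝒜) n).indicator (1 : Ω → ℂ) ω‖ₑ) =
        (spanningSets (μ.trim h𝒜) n).indicator fun ω => ‖u ω‖ₑ := by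
      ext ω
      by_cases hω : ω ∈ spanningSets (μ.trim h𝒜) n <;> simp [hω]
    rw [e] at h
    filter_upwards [h, condLExp_indicator h𝒜 (fun ω => ‖u ω‖ₑ) (hS n)] with ω h₁ h₂ hω
    rwa [h₂, Set.indicator_of_mem hω] at h₁
  filter_upwards [ae_all_iff.2 hfin] with ω h
  obtain ⟨n, hn⟩ := Set.mem_iUnion.1 ((iUnion_spanningSets (μ.trim h𝒜)).symm ▸ Set.mem_univ ω)
  exact h n hn

lemma memLp_top_condE (h𝒜 : 𝒜 ≤ mΩ) [SigmaFinite (μ.trim h𝒜)] (hΦ : IsYoung Φ)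
    (hT : EMBounded 𝒜 μ Φ u) : MemLp (condE 𝒜 μ u) ∞ (μ.trim h𝒜) := by
  obtain ⟨-, K, hK⟩ := hT
  have hmeas : Measurable[𝒜] (condE 𝒜 μ u) := measurable_condE u
  refine memLp_top_of_bound hmeas.aestronglyMeasurable (K + 1) ?_
  by_contra hne
  obtain ⟨B, hB, hBS, s, hs, hsB⟩ := exists_normalized_subset hΦ h𝒜
    (S := {ω | ¬ ‖condE 𝒜 μ u ω‖ ≤ K + 1}) (measurable_norm.comp hmeas measurableSet_Iic).compl
    (fun h => hne (ae_iff.2 h))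
  have h := mul_le_of_luxNorm_EM_le hΦ hK (measurable_one.indicator (h𝒜 _ hB)) (h𝒜 _ hB) hs hsB
    one_pos (L := K + 1) (by positivity) ?_ ?_
  · linarith
  · have e : (fun ω => ENNReal.ofReal (Φ (s * 1 * ‖B.indicator (1 : Ω → ℂ) ω‖))) =
        B.indicator fun _ => ENNReal.ofReal (Φ s) := by
      ext ω
      by_cases hω : ω ∈ B <;> simp [hω, hΦ.map_zero]
    rw [e, lintegral_indicator_const (h𝒜 _ hB), hsB]
  · have e : (fun ω => u ω * B.indicator (1 : Ω → ℂ) ω) = B.indicator u := by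
      ext ω
      by_cases hω : ω ∈ B <;> simp [hω]
    filter_upwards [condE_indicator h𝒜 u hB] with ω h hω
    unfold EM
    rw [e, h, Set.indicator_of_mem hω]
    exact (not_le.1 (hBS hω)).le

/-! ### Part (b): the dual test function. -/

/-- The function `Ψ(|u|)/2` cut off where `|u| > n`. -/
noncomputable def truncComplYoung (Φ : ℝ → ℝ) (u : Ω → ℂ) (n : ℕ) (ω : Ω) : ℝ :=
  if ‖u ω‖ ≤ n then complYoung Φ ‖u ω‖ / 2 else 0

/-- A function `f` with `u f = truncComplYoung Φ u n` and `Φ(|f|) ≤ truncComplYoung Φ u n`. -/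
noncomputable def dualTest (Φ : ℝ → ℝ) (u : Ω → ℂ) (n : ℕ) (ω : Ω) : ℂ :=
  if ‖u ω‖ ≤ n then
    starRingEnd ℂ (u ω) * ((complYoung Φ ‖u ω‖ / (2 * ‖u ω‖ ^ 2) : ℝ) : ℂ) else 0

lemma truncComplYoung_nonneg (hΦ : IsYoung Φ) (n : ℕ) (ω : Ω) : 0 ≤ truncComplYoung Φ u n ω := by
  unfold truncComplYoung
  split_ifs
  · exact div_nonneg (hΦ.complYoung_nonneg _) zero_le_two
  · exact le_rfl

lemma truncComplYoung_le (hΦ : IsYoung Φ) (n : ℕ) (ω : Ω) :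
    truncComplYoung Φ u n ω ≤ complYoung Φ n / 2 := by
  unfold truncComplYoung
  split_ifs with h
  · have : |‖u ω‖| ≤ |(n : ℝ)| := by rwa [abs_norm, Nat.abs_cast]
    linarith [hΦ.complYoung_mono this]
  · exact div_nonneg (hΦ.complYoung_nonneg _) zero_le_two

lemma measurable_truncComplYoung (hΦ : IsYoung Φ) (hu : Measurable u) (n : ℕ) :
    Measurable (truncComplYoung Φ u n) :=
  Measurable.ite (measurableSet_le hu.norm measurable_const)
    ((hΦ.measurable_complYoung.comp hu.norm).div_const 2) measurable_const

lemma measurable_dualTest (hΦ : IsYoung Φ) (hu : Measurable u) (n : ℕ) :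
    Measurable (dualTest Φ u n) :=
  Measurable.ite (measurableSet_le hu.norm measurable_const)
    (((Complex.continuous_conj.measurable).comp hu).mul (Complex.measurable_ofReal.comp
      ((hΦ.measurable_complYoung.comp hu.norm).div ((hu.norm.pow_const 2).const_mul 2))))
    measurable_const

lemma mul_dualTest (hΦ : IsYoung Φ) (n : ℕ) (ω : Ω) :
    u ω * dualTest Φ u n ω = (truncComplYoung Φ u n ω : ℂ) := by
  unfold dualTest truncComplYoung
  split_ifs
  · rcases eq_or_ne (u ω) 0 with h | h
    · simp [h, hΦ.complYoung_zero]
    · have h' : (‖u ω‖ : ℂ) ≠ 0 := by simpa using h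
      rw [← mul_assoc, Complex.mul_conj']
      push_cast
      field_simp
  · simp

lemma map_norm_dualTest_le (hΦ : IsYoung Φ) (n : ℕ) (ω : Ω) :
    Φ ‖dualTest Φ u n ω‖ ≤ truncComplYoung Φ u n ω := by
  unfold dualTest truncComplYoung
  split_ifs
  · rcases eq_or_ne (u ω) 0 with h | h
    · simp [h, hΦ.complYoung_zero, hΦ.map_zero]
    · have h' : 0 < ‖u ω‖ := norm_pos_iff.2 h
      have e : ‖starRingEnd ℂ (u ω) * ((complYoung Φ ‖u ω‖ / (2 * ‖u ω‖ ^ 2) : ℝ) : ℂ)‖ =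
          complYoung Φ ‖u ω‖ / (2 * ‖u ω‖) := by
        rw [norm_mul, Complex.norm_conj, Complex.norm_real, Real.norm_of_nonneg
          (div_nonneg (hΦ.complYoung_nonneg _) (by positivity))]
        field_simp
      rw [e]
      exact hΦ.map_complYoung_div_le h'
  · simp [hΦ.map_zero]

lemma exists_condLExp_truncComplYoung_le (h𝒜 : 𝒜 ≤ mΩ) [SigmaFinite (μ.trim h𝒜)]
    (hΦ : IsYoung Φ) (hu : Measurable u) (hΔ : DeltaPrime Φ)
    (hΨ : ∀ y, complYoung Φ y = 0 → y = 0) (hT : EMBounded 𝒜 μ Φ u) :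
    ∃ M : ℝ, 0 ≤ M ∧ ∀ n, condLExp 𝒜 μ (fun ω => ENNReal.ofReal (truncComplYoung Φ u n ω))
      ≤ᵐ[μ] fun _ => ENNReal.ofReal M := by
  obtain ⟨c, hc, hΔ⟩ := hΔ
  obtain ⟨-, K, hK⟩ := hT
  set k : ℝ := K + 1 with hk
  have hk₀ : 0 < k := by positivity
  -- This `δ` makes `c² * (δ * t) * (2 * m) = 1` for `t = 2k/m`.
  obtain ⟨x₀, hx₀, hsmall⟩ := hΦ.exists_forall_le_mul hΨ (δ := (4 * k * c ^ 2)⁻¹) (by positivity)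
  refine ⟨2 * (2 * k / x₀), by positivity, fun n => ?_⟩
  set W := condLExp 𝒜 μ (fun ω => ENNReal.ofReal (truncComplYoung Φ u n ω)) with hW
  have hWm : Measurable[𝒜] W := measurable_condLExp 𝒜 μ _
  have hWn : W ≤ᵐ[μ] fun _ => ENNReal.ofReal (complYoung Φ n / 2) := by
    have h := condLExp_mono (mΩ := 𝒜) (P := μ)
      (ae_of_all μ fun ω => ENNReal.ofReal_le_ofReal (truncComplYoung_le (u := u) hΦ n ω))
    rwa [condLExp_const h𝒜] at h
  have hess : essSup W (μ.trim h𝒜) ≠ ∞ := ne_top_of_le_ne_top ENNReal.ofReal_ne_top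
    (essSup_le_of_ae_le _ (StronglyMeasurable.ae_le_trim_of_stronglyMeasurable h𝒜 hWm.stronglyMeasurable
      stronglyMeasurable_const hWn))
  suffices hle : essSup W (μ.trim h𝒜) ≤ ENNReal.ofReal (2 * (2 * k / x₀)) from
    (ae_of_ae_trim h𝒜 (ENNReal.ae_le_essSup W)).mono fun ω h => h.trans hle
  by_contra! hlt
  set m := (essSup W (μ.trim h𝒜)).toReal / 2 with hm
  have hess_eq : essSup W (μ.trim h𝒜) = ENNReal.ofReal (2 * m) := by
    rw [hm, mul_div_cancel₀ _ two_ne_zero, ENNReal.ofReal_toReal hess]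
  have hMm : 2 * k / x₀ < m := by
    rw [hess_eq] at hlt
    linarith [(ENNReal.ofReal_lt_ofReal_iff'.1 hlt).1]
  have hm₀ : 0 < m := lt_trans (by positivity) hMm
  obtain ⟨B, hB, hBS, s, hs, hsB⟩ := exists_normalized_subset hΦ h𝒜
    (S := {ω | ¬ W ω ≤ ENNReal.ofReal m}) (hWm measurableSet_Iic).compl
    (fun h => by
      have := essSup_le_of_ae_le (μ := μ.trim h𝒜) (f := W) (ENNReal.ofReal m) (ae_iff.2 h)
      rw [hess_eq, ENNReal.ofReal_le_ofReal_iff hm₀.le] at this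
      linarith)
  -- Then `m * t = 2k > K`, while `m > 2k/x₀` keeps `t` below `x₀`.
  set t := 2 * k / m with ht
  have ht₀ : 0 < t := by positivity
  have hΦt : c ^ 2 * Φ t * (2 * m) ≤ 1 := by
    have h := hsmall t ht₀.le (by
      rw [ht, div_le_iff₀ hm₀]
      rw [div_lt_iff₀ hx₀] at hMm
      linarith)
    calc c ^ 2 * Φ t * (2 * m) ≤ c ^ 2 * ((4 * k * c ^ 2)⁻¹ * t) * (2 * m) := by gcongr
      _ = 1 := by rw [ht]; field_simp; norm_num
  have h := mul_le_of_luxNorm_EM_le hΦ hK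
    ((measurable_dualTest hΦ hu n).indicator (h𝒜 _ hB)) (h𝒜 _ hB) hs hsB ht₀ (L := m) hm₀.le ?_ ?_
  · have : m * t = 2 * k := by rw [ht]; field_simp
    linarith
  · have hpt : ∀ ω, ENNReal.ofReal (Φ (s * t * ‖B.indicator (dualTest Φ u n) ω‖)) ≤
        B.indicator (fun ω => ENNReal.ofReal (c ^ 2 * Φ s * Φ t) *
          ENNReal.ofReal (truncComplYoung Φ u n ω)) ω := fun ω => by
      by_cases hω : ω ∈ B
      · rw [Set.indicator_of_mem hω, Set.indicator_of_mem hω, ← ENNReal.ofReal_mul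
          (mul_nonneg (mul_nonneg (by positivity) (hΦ.nonneg s)) (hΦ.nonneg t))]
        refine ENNReal.ofReal_le_ofReal ?_
        have hs' := hΦ.nonneg s
        have ht' := hΦ.nonneg t
        calc Φ (s * t * ‖dualTest Φ u n ω‖)
            ≤ c * Φ (s * t) * Φ ‖dualTest Φ u n ω‖ := hΔ _ _ (by positivity) (norm_nonneg _)
          _ ≤ c * (c * Φ s * Φ t) * truncComplYoung Φ u n ω := by
            have := hΦ.nonneg ‖dualTest Φ u n ω‖
            gcongr
            · exact hΔ s t hs.le ht₀.le
            · exact map_norm_dualTest_le hΦ n ω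
          _ = c ^ 2 * Φ s * Φ t * truncComplYoung Φ u n ω := by ring
      · simp [hω, hΦ.map_zero]
    have hWB : ∫⁻ ω in B, W ω ∂μ ≤ ENNReal.ofReal (2 * m) * μ B := by
      rw [← setLIntegral_const, ← hess_eq]
      exact lintegral_mono_ae (ae_restrict_of_ae (ae_of_ae_trim h𝒜 (ENNReal.ae_le_essSup W)))
    calc ∫⁻ ω, ENNReal.ofReal (Φ (s * t * ‖B.indicator (dualTest Φ u n) ω‖)) ∂μ
        ≤ ENNReal.ofReal (c ^ 2 * Φ s * Φ t) * ∫⁻ ω in B, W ω ∂μ := by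
          refine (lintegral_mono hpt).trans_eq ?_
          rw [lintegral_indicator (h𝒜 _ hB), lintegral_const_mul' _ _ ENNReal.ofReal_ne_top, hW,
            setLIntegral_condLExp h𝒜 μ _ hB]
      _ ≤ ENNReal.ofReal (c ^ 2 * Φ s * Φ t) * (ENNReal.ofReal (2 * m) * μ B) := by gcongr
      _ = ENNReal.ofReal (c ^ 2 * Φ t * (2 * m) * Φ s) * μ B := by
          rw [← mul_assoc, ← ENNReal.ofReal_mul
            (mul_nonneg (mul_nonneg (by positivity) (hΦ.nonneg s)) (hΦ.nonneg t))]
          congr 2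
          ring
      _ ≤ ENNReal.ofReal (Φ s) * μ B := by
          gcongr
          exact mul_le_of_le_one_left (hΦ.nonneg s) hΦt
      _ = 1 := hsB
  · have e : (fun ω => u ω * B.indicator (dualTest Φ u n) ω) =
        B.indicator fun ω => (truncComplYoung Φ u n ω : ℂ) := by
      ext ω
      by_cases hω : ω ∈ B <;> simp [hω, mul_dualTest hΦ]
    filter_upwards [condE_indicator h𝒜 (fun ω => (truncComplYoung Φ u n ω : ℂ)) hB, hWn]
      with ω h hn hω
    unfold EM
    rw [e, h, Set.indicator_of_mem hω, condE_ofReal (truncComplYoung_nonneg hΦ n),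
      Complex.norm_real, Real.norm_of_nonneg ENNReal.toReal_nonneg]
    exact (ENNReal.ofReal_le_iff_le_toReal (hn.trans_lt ENNReal.ofReal_lt_top).ne).1
      (not_le.1 (hBS hω)).le

lemma memLp_top_invCondE (h𝒜 : 𝒜 ≤ mΩ) [SigmaFinite (μ.trim h𝒜)]
    (hΦ : IsYoung Φ) (hu : Measurable u) (hΔ : DeltaPrime Φ)
    (hΨ : ∀ y, complYoung Φ y = 0 → y = 0) (hT : EMBounded 𝒜 μ Φ u) :
    MemLp (invCondE 𝒜 μ (complYoung Φ) u) ∞ (μ.trim h𝒜) := by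
  obtain ⟨M, hM₀, hM⟩ := exists_condLExp_truncComplYoung_le h𝒜 hΦ hu hΔ hΨ hT
  have hmeas : Measurable[𝒜] (invCondE 𝒜 μ (complYoung Φ) u) :=
    (youngInv_mono _).measurable.comp (measurable_condLExp 𝒜 μ _)
  refine ⟨hmeas.aestronglyMeasurable, ?_⟩
  rw [eLpNorm_exponent_top]
  refine (essSup_le_of_ae_le (ENNReal.ofReal (2 * M + Φ 1)) ?_).trans_lt ENNReal.ofReal_lt_top
  have hmono : Monotone fun (n : ℕ) ω => ENNReal.ofReal (truncComplYoung Φ u n ω) := by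
    intro i j hij ω
    refine ENNReal.ofReal_le_ofReal ?_
    by_cases h : ‖u ω‖ ≤ i
    · have h' : ‖u ω‖ ≤ j := h.trans (by exact_mod_cast hij)
      simp [truncComplYoung, h, h']
    · have := truncComplYoung_nonneg (u := u) hΦ j ω
      simpa [truncComplYoung, h] using this
  have hsup : ∀ ω, ENNReal.ofReal (complYoung Φ ‖u ω‖) =
      2 * ⨆ n : ℕ, ENNReal.ofReal (truncComplYoung Φ u n ω) := fun ω => by
    have h2 : ENNReal.ofReal (complYoung Φ ‖u ω‖) =
        2 * ENNReal.ofReal (complYoung Φ ‖u ω‖ / 2) := by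
      rw [← ENNReal.ofReal_ofNat 2, ← ENNReal.ofReal_mul zero_le_two,
        mul_div_cancel₀ _ two_ne_zero]
    rw [h2]
    congr 1
    refine le_antisymm ?_ (iSup_le fun n => ENNReal.ofReal_le_ofReal ?_)
    · obtain ⟨n, hn⟩ := exists_nat_ge ‖u ω‖
      exact le_iSup_of_le n (by simp [truncComplYoung, hn])
    · unfold truncComplYoung
      split_ifs
      · exact le_rfl
      · exact div_nonneg (hΦ.complYoung_nonneg _) zero_le_two
  have h₁ := condLExp_le_of_monotone h𝒜
    (fun n => (measurable_truncComplYoung hΦ hu n).ennreal_ofReal) hmono hM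
  have h₂ := ae_eq_trim_of_measurable h𝒜 (measurable_condLExp 𝒜 μ _)
    ((measurable_condLExp 𝒜 μ _).const_mul 2) (condLExp_const_mul (μ := μ) h𝒜
      (fun ω => ⨆ n : ℕ, ENNReal.ofReal (truncComplYoung Φ u n ω)) ENNReal.ofNat_ne_top)
  filter_upwards [h₁, h₂] with ω e₁ e₂
  rw [enorm_eq_self]
  refine le_trans (youngInv_mono _ ?_) (hΦ.youngInv_complYoung_le (by positivity))
  simp only [hsup]
  rw [e₂, ENNReal.ofReal_mul zero_le_two, ENNReal.ofReal_ofNat]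
  gcongr

/-! ### Part (c): from Hölder's inequality to boundedness. -/

/-- The norm is at most `1` on a suitable multiple of any function in the Orlicz space. -/
lemma MemOrlicz.exists_lintegral_le_one (hΦ : IsYoung Φ) {f : Ω → ℂ} (hf : MemOrlicz Φ μ f) :
    ∃ k : ℝ, 0 < k ∧ ∫⁻ ω, ENNReal.ofReal (Φ (‖f ω‖ / k)) ∂μ ≤ 1 := by
  obtain ⟨-, k, hk, hint⟩ := hf
  set I := ∫⁻ ω, ENNReal.ofReal (Φ (k * ‖f ω‖)) ∂μ with hI
  -- Convexity gives `Φ(εx) ≤ ε Φ(x)`, and this `ε` makes `ε I ≤ 1`.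
  set ε : ℝ := (I.toReal + 1)⁻¹ with hε
  have hI₀ : 0 ≤ I.toReal := ENNReal.toReal_nonneg
  have hε₀ : 0 < ε := by positivity
  have hε₁ : ε ≤ 1 := inv_le_one_of_one_le₀ (by linarith)
  refine ⟨(ε * k)⁻¹, by positivity, ?_⟩
  calc ∫⁻ ω, ENNReal.ofReal (Φ (‖f ω‖ / (ε * k)⁻¹)) ∂μ
      ≤ ∫⁻ ω, ENNReal.ofReal ε * ENNReal.ofReal (Φ (k * ‖f ω‖)) ∂μ := by
        refine lintegral_mono fun ω => ?_
        rw [← ENNReal.ofReal_mul hε₀.le]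
        refine ENNReal.ofReal_le_ofReal ?_
        have e : ‖f ω‖ / (ε * k)⁻¹ = ε * (k * ‖f ω‖) := by rw [div_inv_eq_mul]; ring
        rw [e]
        exact hΦ.map_mul_le hε₀.le hε₁ _
    _ = ENNReal.ofReal (ε * I.toReal) := by
        rw [lintegral_const_mul' _ _ ENNReal.ofReal_ne_top, ← hI, ENNReal.ofReal_mul hε₀.le,
          ENNReal.ofReal_toReal hint.ne]
    _ ≤ 1 := by
        rw [ENNReal.ofReal_le_one, hε, inv_mul_le_iff₀ (by positivity)]
        linarith

lemma luxNorm_le_mul {f g : Ω → ℂ} (hΦ : IsYoung Φ) (hf : MemOrlicz Φ μ f) {R : ℝ≥0}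
    (h : ∀ k : ℝ, 0 < k → ∫⁻ ω, ENNReal.ofReal (Φ (‖f ω‖ / k)) ∂μ ≤ 1 →
      luxNorm Φ μ g ≤ R * ENNReal.ofReal k) : luxNorm Φ μ g ≤ R * luxNorm Φ μ f := by
  rcases eq_or_ne R 0 with rfl | hR
  -- Division by `R` is unavailable here; one admissible `k` already forces the left side to be `0`.
  · obtain ⟨k, hk, hint⟩ := hf.exists_lintegral_le_one hΦ
    simpa using h k hk hint
  · have hR' : (R : ℝ≥0∞) ≠ 0 := by simpa using hR
    rw [← ENNReal.div_le_iff' hR' ENNReal.coe_ne_top]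
    refine le_iInf fun k => le_iInf fun hk => le_iInf fun hint => ?_
    rw [ENNReal.div_le_iff' hR' ENNReal.coe_ne_top]
    exact h k hk hint

lemma setLIntegral_complYoung_lt_top (h𝒜 : 𝒜 ≤ mΩ) [SigmaFinite (μ.trim h𝒜)] {M : ℝ≥0}
    (hM : ∀ᵐ ω ∂μ, invCondE 𝒜 μ (complYoung Φ) u ω ≤ M) {A : Set Ω} (hA : MeasurableSet[𝒜] A)
    (hμA : μ A < ∞) : ∫⁻ ω in A, ENNReal.ofReal (complYoung Φ ‖u ω‖) ∂μ < ∞ := by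
  rw [← setLIntegral_condLExp h𝒜 μ _ hA]
  refine lt_of_le_of_lt (lintegral_mono_ae (g := fun _ => ENNReal.ofReal
    (complYoung Φ (M + 1 : ℝ≥0))) (ae_restrict_of_ae ?_)) ?_
  · filter_upwards [hM] with ω h
    -- The strict bound `Ψ⁻¹(E(Ψ(u))) < M + 1` is what yields `E(Ψ(u)) < Ψ(M + 1)`.
    exact (lt_of_youngInv_lt (h.trans_lt (by exact_mod_cast lt_add_one M))).le
  · rw [setLIntegral_const]
    exact ENNReal.mul_lt_top ENNReal.ofReal_lt_top hμA

/-- Since `u` need not belong to `L^Ψ`, Hölder's inequality is applied to `1_A u` with `μ(A) < ∞`;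
on `A ∈ 𝒜` the indicator disappears from the conditional expectations. -/
lemma condLExp_enorm_mul_le (h𝒜 : 𝒜 ≤ mΩ) [SigmaFinite (μ.trim h𝒜)] (hΦ : IsYoung Φ)
    (hu : Measurable u) {C M : ℝ≥0} (hH : CondHolder 𝒜 μ Φ C)
    (hM : ∀ᵐ ω ∂μ, invCondE 𝒜 μ (complYoung Φ) u ω ≤ M) {f : Ω → ℂ} (hf : MemOrlicz Φ μ f) :
    ∀ᵐ ω ∂μ, condLExp 𝒜 μ (fun ω => ‖u ω * f ω‖ₑ) ω ≤ C * M * invCondE 𝒜 μ Φ f ω := by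
  have hS := fun n => measurableSet_spanningSets (μ.trim h𝒜) n
  have hloc : ∀ n, ∀ᵐ ω ∂μ, ω ∈ spanningSets (μ.trim h𝒜) n →
      condLExp 𝒜 μ (fun ω => ‖u ω * f ω‖ₑ) ω ≤ C * M * invCondE 𝒜 μ Φ f ω := fun n => by
    set A := spanningSets (μ.trim h𝒜) n with hA
    have e₁ : (fun ω => ENNReal.ofReal (complYoung Φ ‖A.indicator u ω‖)) =
        A.indicator fun ω => ENNReal.ofReal (complYoung Φ ‖u ω‖) := by
      ext ω
      by_cases hω : ω ∈ A <;> simp [hω, hΦ.complYoung_zero]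
    have e₂ : (fun ω => ‖f ω * A.indicator u ω‖ₑ) = A.indicator fun ω => ‖u ω * f ω‖ₑ := by
      ext ω
      by_cases hω : ω ∈ A <;> simp [hω, mul_comm]
    have hg : MemOrlicz (complYoung Φ) μ (A.indicator u) := by
      refine ⟨hu.indicator (h𝒜 _ (hS n)), 1, one_pos, ?_⟩
      simp only [one_mul]
      rw [e₁, lintegral_indicator (h𝒜 _ (hS n))]
      exact setLIntegral_complYoung_lt_top h𝒜 hM (hS n)
        (measure_spanningSets_trim_lt_top h𝒜 μ n)
    have h := hH f _ hf hg
    rw [e₂] at h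
    filter_upwards [h, condLExp_indicator h𝒜 (fun ω => ‖u ω * f ω‖ₑ) (hS n),
      condLExp_indicator h𝒜 (fun ω => ENNReal.ofReal (complYoung Φ ‖u ω‖)) (hS n), hM]
      with ω h₁ h₂ h₃ h₄ hω
    rw [h₂, Set.indicator_of_mem hω] at h₁
    rw [Set.indicator_of_mem hω] at h₃
    refine h₁.trans ?_
    rw [mul_right_comm]
    gcongr
    refine le_trans (le_of_eq ?_) h₄
    unfold invCondE
    rw [e₁, h₃]
  filter_upwards [ae_all_iff.2 hloc] with ω h
  obtain ⟨n, hn⟩ := Set.mem_iUnion.1 ((iUnion_spanningSets (μ.trim h𝒜)).symm ▸ Set.mem_univ ω)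
  exact h n hn

/-- A positive `R ≥ C * M` replaces `C * M`, which may vanish and could then not be divided by. -/
lemma lintegral_EM_div_le (h𝒜 : 𝒜 ≤ mΩ) [SigmaFinite (μ.trim h𝒜)] (hΦ : IsYoung Φ)
    (hu : Measurable u) (hT : EMWellDefined 𝒜 μ Φ u) {C M : ℝ≥0} (hH : CondHolder 𝒜 μ Φ C)
    (hM : ∀ᵐ ω ∂μ, invCondE 𝒜 μ (complYoung Φ) u ω ≤ M) {f : Ω → ℂ} (hf : MemOrlicz Φ μ f)
    {k R : ℝ} (hk : 0 < k) (hint : ∫⁻ ω, ENNReal.ofReal (Φ (‖f ω‖ / k)) ∂μ ≤ 1) (hR : 0 < R)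
    (hCR : (C * M : ℝ) ≤ R) :
    ∫⁻ ω, ENNReal.ofReal (Φ (‖EM 𝒜 μ u f ω‖ / (R * k))) ∂μ ≤ 1 := by
  have hnorm : ∀ ω, ‖f ω / (k : ℂ)‖ = ‖f ω‖ / k := fun ω => by
    rw [norm_div, Complex.norm_real, Real.norm_of_nonneg hk.le]
  have hf' : MemOrlicz Φ μ fun ω => f ω / (k : ℂ) :=
    ⟨hf.1.div_const _, 1, one_pos, by
      simpa only [one_mul, hnorm] using hint.trans_lt ENNReal.one_lt_top⟩
  refine le_trans ?_ hint
  rw [← lintegral_condLExp h𝒜 μ fun ω => ENNReal.ofReal (Φ (‖f ω‖ / k))]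
  have hscale : (fun ω => ‖u ω * (f ω / (k : ℂ))‖ₑ) =
      fun ω => ENNReal.ofReal k⁻¹ * ‖u ω * f ω‖ₑ := by
    ext ω
    rw [← ofReal_norm, ← ofReal_norm, ← ENNReal.ofReal_mul (by positivity), norm_mul, hnorm,
      norm_mul]
    congr 1
    field_simp
  have hH' := condLExp_enorm_mul_le h𝒜 hΦ hu hH hM hf'
  rw [hscale] at hH'
  refine lintegral_mono_ae ?_
  filter_upwards [enorm_condE_le h𝒜 (hT f hf), hH', condLExp_const_mul (μ := μ) h𝒜
    (fun ω => ‖u ω * f ω‖ₑ) (c := ENNReal.ofReal k⁻¹) ENNReal.ofReal_ne_top] with ω h₁ h₂ h₃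
  refine hΦ.le_of_le_youngInv (by positivity) ?_
  have h₄ : ENNReal.ofReal (‖EM 𝒜 μ u f ω‖ / k) ≤
      ENNReal.ofReal R * invCondE 𝒜 μ Φ (fun ω => f ω / (k : ℂ)) ω := by
    calc ENNReal.ofReal (‖EM 𝒜 μ u f ω‖ / k)
        = ENNReal.ofReal k⁻¹ * ‖EM 𝒜 μ u f ω‖ₑ := by
          rw [← ofReal_norm, ← ENNReal.ofReal_mul (by positivity), div_eq_inv_mul]
      _ ≤ ENNReal.ofReal k⁻¹ * condLExp 𝒜 μ (fun ω => ‖u ω * f ω‖ₑ) ω := by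
          gcongr
          exact h₁
      _ ≤ C * M * invCondE 𝒜 μ Φ (fun ω => f ω / (k : ℂ)) ω := by rwa [← h₃]
      _ ≤ ENNReal.ofReal R * invCondE 𝒜 μ Φ (fun ω => f ω / (k : ℂ)) ω := by
          gcongr
          rw [← ENNReal.coe_mul, ← ENNReal.ofReal_coe_nnreal]
          exact ENNReal.ofReal_le_ofReal (by push_cast; exact hCR)
  have h₅ : invCondE 𝒜 μ Φ (fun ω => f ω / (k : ℂ)) ω =
      youngInv Φ (condLExp 𝒜 μ (fun ω => ENNReal.ofReal (Φ (‖f ω‖ / k))) ω) := by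
    unfold invCondE
    simp only [hnorm]
  rw [← h₅, ← ENNReal.mul_le_mul_iff_right (a := ENNReal.ofReal R)
    (by simpa using hR) ENNReal.ofReal_ne_top, ← ENNReal.ofReal_mul hR.le]
  convert h₄ using 2
  field_simp

lemma memOrlicz_EM_and_luxNorm_EM_le (h𝒜 : 𝒜 ≤ mΩ) [SigmaFinite (μ.trim h𝒜)] (hΦ : IsYoung Φ)
    (hu : Measurable u) (hT : EMWellDefined 𝒜 μ Φ u) {C M : ℝ≥0} (hH : CondHolder 𝒜 μ Φ C)
    (hM : ∀ᵐ ω ∂μ, invCondE 𝒜 μ (complYoung Φ) u ω ≤ M) {f : Ω → ℂ} (hf : MemOrlicz Φ μ f) :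
    MemOrlicz Φ μ (EM 𝒜 μ u f) ∧
      luxNorm Φ μ (EM 𝒜 μ u f) ≤ (C * M : ℝ≥0) * luxNorm Φ μ f := by
  constructor
  · obtain ⟨k, hk, hint⟩ := hf.exists_lintegral_le_one hΦ
    have hR : (0 : ℝ) < C * M + 1 := by positivity
    have h := lintegral_EM_div_le h𝒜 hΦ hu hT hH hM hf hk hint hR (by linarith)
    refine ⟨(measurable_condE _).mono h𝒜 le_rfl, ((C * M + 1) * k)⁻¹, by positivity, ?_⟩
    simpa only [div_eq_inv_mul] using h.trans_lt ENNReal.one_lt_top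
  · refine luxNorm_le_mul hΦ hf fun k hk hint => ?_
    rw [← ENNReal.ofReal_coe_nnreal, ← ENNReal.ofReal_mul (NNReal.coe_nonneg _)]
    refine ENNReal.le_of_forall_pos_le_add fun ε hε _ => ?_
    -- With `R = C * M + ε / k` the resulting bound `R * k` is exactly `C * M * k + ε`.
    have hR : (0 : ℝ) < C * M + ε / k := by positivity
    have h := lintegral_EM_div_le h𝒜 hΦ hu hT hH hM hf hk hint hR
      (le_add_of_nonneg_right (by positivity))
    refine (luxNorm_le (mul_pos hR hk) h).trans ?_
    rw [← ENNReal.ofReal_coe_nnreal (p := ε),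
      ← ENNReal.ofReal_add (by positivity) (NNReal.coe_nonneg _)]
    refine ENNReal.ofReal_le_ofReal (le_of_eq ?_)
    push_cast
    field_simp

end Operator

end OrliczEMu

open OrliczEMu in
theorem theorem2p1 {Ω : Type*} {𝒜 mΩ : MeasurableSpace Ω} (h𝒜 : 𝒜 ≤ mΩ)
    (μ : Measure Ω) [SigmaFinite (μ.trim h𝒜)]
    (Φ : ℝ → ℝ) (hΦ : IsYoung Φ)
    (u : Ω → ℂ) (hu : Measurable u) (hT : EMWellDefined 𝒜 μ Φ u) :
    -- (a)
    (EMBounded 𝒜 μ Φ u →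
      Conditionable 𝒜 μ u ∧ MemLp (condE 𝒜 μ u) ∞ (μ.trim h𝒜)) ∧
    -- (b), for a complementary function that vanishes only at the origin
    (DeltaPrime Φ → (∀ y, complYoung Φ y = 0 → y = 0) → EMBounded 𝒜 μ Φ u →
      MemLp (invCondE 𝒜 μ (complYoung Φ) u) ∞ (μ.trim h𝒜)) ∧
    -- (c)
    (∀ C : ℝ≥0, 0 < C → CondHolder 𝒜 μ Φ C →
      MemLp (invCondE 𝒜 μ (complYoung Φ) u) ∞ (μ.trim h𝒜) →
      EMBounded 𝒜 μ Φ u ∧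
        EMNorm 𝒜 μ Φ u ≤ C * eLpNorm (invCondE 𝒜 μ (complYoung Φ) u) ∞ (μ.trim h𝒜)) := by
  refine ⟨fun hb => ⟨conditionable_of_EMWellDefined h𝒜 hΦ hu hT, memLp_top_condE h𝒜 hΦ hb⟩,
    fun hΔ hΨ hb => memLp_top_invCondE h𝒜 hΦ hu hΔ hΨ hb, fun C _ hH hmem => ?_⟩
  set M := (eLpNorm (invCondE 𝒜 μ (complYoung Φ) u) ∞ (μ.trim h𝒜)).toNNReal with hM
  have hMe : (M : ℝ≥0∞) = eLpNorm (invCondE 𝒜 μ (complYoung Φ) u) ∞ (μ.trim h𝒜) :=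
    ENNReal.coe_toNNReal hmem.2.ne
  have hbound : ∀ᵐ ω ∂μ, invCondE 𝒜 μ (complYoung Φ) u ω ≤ M := by
    rw [hMe, eLpNorm_exponent_top]
    exact ae_of_ae_trim h𝒜 (ENNReal.ae_le_essSup _)
  have hmain := fun f (hf : MemOrlicz Φ μ f) =>
    memOrlicz_EM_and_luxNorm_EM_le h𝒜 hΦ hu hT hH hbound hf
  refine ⟨⟨fun f hf => (hmain f hf).1, C * M, fun f hf => (hmain f hf).2⟩, ?_⟩
  rw [← hMe, ← ENNReal.coe_mul]
  exact iInf₂_le (C * M) fun f hf => (hmain f hf).2
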